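/- A *Boolean space* is a zero-dimensional locally compact Hausdorff space (zero-dimensional: the clopen sets form a base). A map between topological spaces is *perfect* if it is continuous, closed, and all its point inverses are compact. Let $\mathbf{PZLC}$ be the category of Boolean spaces and perfect maps. An ideal $I$ of a Boolean algebra $A$ (where $0=1$ is allowed) is *dense* if for every $b\in A\setminus\{0\}$ there is $a\in I\setminus\{0\}$ with $a\le b$. A *prime local Boolean algebra* (PLBA) is a pair $(A,I)$ where $A$ is a Boolean algebra and $I$ is a dense ideal of $A$ such that $I=A$ or $I$ is a prime ideal of $A$ (equivalently, $I=A$ or $I$ is a non-principal prime ideal of $A$). Let $\mathbf{PLBA}$ be the category whose objects are all PLBAs and whose morphisms $\varphi:(A,I)\to(B,J)$ are the Boolean homomorphisms $\varphi:A\to B$ such that 1. for every $b\in J$ there exists $a\in I$ with $b\le\varphi(a)$, and 2. $\varphi(I)\subseteq J$, with the usual composition and identities. **Theorem.** The category $\mathbf{PZLC}$ is dually equivalent to the category $\mathbf{PLBA}$, i.e. the opposite category $\mathbf{PZLC}^{\mathrm{op}}$ is equivalent to $\mathbf{PLBA}$. -/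

import Mathlib

open CategoryTheory

universe u

/-- A map between topological spaces is *perfect* if it is continuous and closed and all its
point inverses are compact. -/
structure IsPerfectMap {X Y : Type*} [TopologicalSpace X] [TopologicalSpace Y] (f : X → Y) :
    Prop where
  continuous : Continuous f
  isClosedMap : IsClosedMap f
  isCompact_fiber : ∀ y : Y, IsCompact (f ⁻¹' {y})

theorem isPerfectMap_iff_isProperMap {X Y : Type*} [TopologicalSpace X] [TopologicalSpace Y]
    {f : X → Y} : IsPerfectMap f ↔ IsProperMap f := by
  rw [isProperMap_iff_isClosedMap_and_compact_fibers]
  exact ⟨fun h => ⟨h.1, h.2, h.3⟩, fun h => ⟨h.1, h.2.1, h.2.2⟩⟩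

theorem IsPerfectMap.id {X : Type*} [TopologicalSpace X] : IsPerfectMap (id : X → X) :=
  isPerfectMap_iff_isProperMap.2 isProperMap_id

theorem IsPerfectMap.comp {X Y Z : Type*} [TopologicalSpace X] [TopologicalSpace Y]
    [TopologicalSpace Z] {g : Y → Z} {f : X → Y} (hg : IsPerfectMap g) (hf : IsPerfectMap f) :
    IsPerfectMap (g ∘ f) :=
  isPerfectMap_iff_isProperMap.2
    ((isPerfectMap_iff_isProperMap.1 hg).comp (isPerfectMap_iff_isProperMap.1 hf))

/-- A *Boolean space*: a zero-dimensional locally compact Hausdorff space. Zero-dimensional means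
that the clopen sets form a base of the topology. -/
structure PZLC : Type (u + 1) where
  carrier : Type u
  [top : TopologicalSpace carrier]
  [t2 : T2Space carrier]
  [locallyCompact : LocallyCompactSpace carrier]
  zeroDim : TopologicalSpace.IsTopologicalBasis {s : Set carrier | IsClopen s}

attribute [instance] PZLC.top PZLC.t2 PZLC.locallyCompact

namespace PZLC

/-- The morphisms of `PZLC` are the perfect maps. -/
@[ext]
structure Hom (X Y : PZLC.{u}) : Type u where
  toFun : X.carrier → Y.carrier
  isPerfectMap : IsPerfectMap toFun

/-- The category of Boolean spaces and perfect maps. -/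
instance : Category PZLC.{u} where
  Hom X Y := Hom X Y
  id _ := ⟨id, IsPerfectMap.id⟩
  comp f g := ⟨g.toFun ∘ f.toFun, g.isPerfectMap.comp f.isPerfectMap⟩

end PZLC

/-- An ideal `I` of a Boolean algebra is *dense* if every nonzero element lies above a nonzero
element of `I`. -/
def IsDenseIdeal {A : Type*} [BooleanAlgebra A] (I : Order.Ideal A) : Prop :=
  ∀ b : A, b ≠ ⊥ → ∃ a ∈ I, a ≠ ⊥ ∧ a ≤ b

/-- A *local Boolean algebra*: a Boolean algebra (possibly with `⊥ = ⊤`) with a dense ideal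
(possibly not proper). -/
structure LBA : Type (u + 1) where
  carrier : Type u
  [str : BooleanAlgebra carrier]
  ideal : Order.Ideal carrier
  dense : IsDenseIdeal ideal

attribute [instance] LBA.str

namespace LBA

/-- A morphism `(A, I) ⟶ (B, J)` of local Boolean algebras: a Boolean homomorphism `φ` such that
every element of `J` lies below some `φ a` with `a ∈ I`. (A bounded lattice homomorphism between
Boolean algebras automatically preserves complements.) -/
@[ext]
structure Hom (A B : LBA.{u}) : Type u where
  toHom : BoundedLatticeHom A.carrier B.carrier
  cofinal : ∀ b ∈ B.ideal, ∃ a ∈ A.ideal, b ≤ toHom a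

/-- The category of local Boolean algebras. -/
instance : Category LBA.{u} where
  Hom A B := Hom A B
  id A := ⟨BoundedLatticeHom.id A.carrier, fun b hb => ⟨b, hb, le_rfl⟩⟩
  comp φ ψ := ⟨ψ.toHom.comp φ.toHom, fun c hc => by
    obtain ⟨b, hb, hcb⟩ := ψ.cofinal c hc
    obtain ⟨a, ha, hba⟩ := φ.cofinal b hb
    exact ⟨a, ha, hcb.trans (OrderHomClass.mono ψ.toHom hba)⟩⟩

end LBA

/-- A *prime local Boolean algebra*: a local Boolean algebra `(A, I)` such that `I = A` or `I` is a
prime ideal of `A`. -/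
structure PLBA : Type (u + 1) extends LBA.{u} where
  eq_top_or_isPrime : ideal = ⊤ ∨ ideal.IsPrime

namespace PLBA

/-- The morphisms `(A, I) ⟶ (B, J)` of `PLBA` are the morphisms `φ` of local Boolean algebras with
`φ(I) ⊆ J`. -/
@[ext]
structure Hom (A B : PLBA.{u}) : Type u where
  toLBAHom : A.toLBA ⟶ B.toLBA
  map_mem : ∀ a ∈ A.ideal, toLBAHom.toHom a ∈ B.ideal

/-- The category of prime local Boolean algebras, a (not full) subcategory of `LBA`. -/
instance : Category PLBA.{u} where
  Hom A B := Hom A B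
  id A := ⟨𝟙 A.toLBA, fun _ ha => ha⟩
  comp φ ψ := ⟨φ.toLBAHom ≫ ψ.toLBAHom, fun a ha => ψ.map_mem _ (φ.map_mem a ha)⟩

end PLBA

/-!
The duality is Stone duality restricted to the locally compact spaces. A Boolean space `X` is sent
to the algebra of those clopen sets which are compact or have compact complement, with the ideal of
compact clopen sets; a perfect map is sent to its preimage map. This contravariant functor is shown
to be faithful, full and essentially surjective.

*Faithful*: the compact clopen sets separate the points of a Boolean space
(`PZLC.exists_compact_clopen_between`).

*Full*: given `φ` from the algebra of `Y` to that of `X` and a point `x : X`, the compact clopen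
sets `V` of `Y` with `x ∈ φ V` are closed under intersections and nonempty as sets, and there is at
least one of them by the cofinality condition on `φ`. By compactness they have a common point, which
is the value at `x` of the desired map (`PZLC.exists_point`); the map is proper since the preimage
of a compact clopen set `V` is the compact set `φ V`.

*Essentially surjective*: for a prime local Boolean algebra `(A, I)` the space consists of the
ultrafilters of `A` that meet `I` (`LocalStone.Point`). It is an open subspace of the Stone space
of `A`. The sets `{x | a ∈ x}` form a base. Density of `I` makes `a ↦ {x | a ∈ x}` injective; a
compact set of this form has `a ∈ I`, and, `I` being prime or improper, each `a` has `a ∈ I` or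
`aᶜ ∈ I`, so that the image consists precisely of the clopen sets that are compact or
have compact complement.
-/

open TopologicalSpace Order

/-! ### The algebra of compact and cocompact clopen sets -/

namespace PZLC

/-- The Boolean algebra of the clopen sets that are compact or have compact complement. When the
space is compact, these are all the clopen sets. -/
def clopenAlgebra (X : PZLC.{u}) : BooleanSubalgebra (Clopens X.carrier) where
  carrier := {U | IsCompact (U : Set X.carrier) ∨ IsCompact (U : Set X.carrier)ᶜ}
  supClosed' := by
    rintro U hU V hV
    simp only [Set.mem_ofPred_eq, Clopens.coe_sup, Set.compl_union] at hU hV ⊢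
    rcases hU with hU | hU
    · rcases hV with hV | hV
      · exact .inl (hU.union hV)
      · exact .inr (hV.inter_left U.isOpen.isClosed_compl)
    · exact .inr (hU.inter_right V.isOpen.isClosed_compl)
  infClosed' := by
    rintro U hU V hV
    simp only [Set.mem_ofPred_eq, Clopens.coe_inf, Set.compl_inter] at hU hV ⊢
    rcases hU with hU | hU
    · exact .inl (hU.inter_right V.isClosed)
    · rcases hV with hV | hV
      · exact .inl (hV.inter_left U.isClosed)
      · exact .inr (hU.union hV)
  compl_mem' := by
    intro U hU
    simp only [Set.mem_ofPred_eq, Clopens.coe_compl, compl_compl] at hU ⊢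
    exact hU.symm
  bot_mem' := .inl (by simp)

/-- The ideal of compact clopen sets. -/
def compactIdeal (X : PZLC.{u}) : Order.Ideal X.clopenAlgebra where
  carrier := {U | IsCompact (U.1 : Set X.carrier)}
  lower' := fun _ V hVU hU => hU.of_isClosed_subset V.1.isClosed hVU
  nonempty' := ⟨⊥, isCompact_empty⟩
  directed' := fun U hU V hV =>
    ⟨U ⊔ V, IsCompact.union hU hV, le_sup_left, le_sup_right⟩

/-- A compact clopen set as an element of `clopenAlgebra`. -/
def ofCompact {X : PZLC.{u}} (U : Set X.carrier) (hU : IsClopen U) (hc : IsCompact U) :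
    X.clopenAlgebra := ⟨⟨U, hU⟩, .inl hc⟩

theorem exists_compact_clopen_between {X : PZLC.{u}} {K O : Set X.carrier} (hK : IsCompact K)
    (hO : IsOpen O) (h : K ⊆ O) :
    ∃ U : Set X.carrier, IsClopen U ∧ IsCompact U ∧ K ⊆ U ∧ U ⊆ O := by
  have point (x : X.carrier) (hx : x ∈ K) :
      ∃ U : Set X.carrier, IsClopen U ∧ IsCompact U ∧ x ∈ U ∧ U ⊆ O := by
    obtain ⟨C, hC, hxC, hCO⟩ := exists_compact_subset hO (h hx)
    obtain ⟨U, hU, hxU, hUC⟩ := X.zeroDim.exists_subset_of_mem_open hxC isOpen_interior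
    have hUC' := hUC.trans interior_subset
    exact ⟨U, hU, hC.of_isClosed_subset hU.1 hUC', hxU, hUC'.trans hCO⟩
  refine hK.induction_on (p := fun s =>
      ∃ U : Set X.carrier, IsClopen U ∧ IsCompact U ∧ s ⊆ U ∧ U ⊆ O) ?_ ?_ ?_ fun x hx => ?_
  · exact ⟨∅, isClopen_empty, isCompact_empty, le_rfl, Set.empty_subset _⟩
  · rintro s t hst ⟨U, hU, hUc, htU, hUO⟩
    exact ⟨U, hU, hUc, hst.trans htU, hUO⟩
  · rintro s t ⟨U, hU, hUc, hsU, hUO⟩ ⟨V, hV, hVc, htV, hVO⟩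
    exact ⟨U ∪ V, hU.union hV, hUc.union hVc, Set.union_subset_union hsU htV,
      Set.union_subset hUO hVO⟩
  · obtain ⟨U, hU, hUc, hxU, hUO⟩ := point x hx
    exact ⟨U, mem_nhdsWithin_of_mem_nhds (hU.2.mem_nhds hxU), U, hU, hUc, le_rfl, hUO⟩

theorem exists_compact_clopen_mem {X : PZLC.{u}} {x : X.carrier} {O : Set X.carrier}
    (hO : IsOpen O) (hx : x ∈ O) :
    ∃ U : Set X.carrier, IsClopen U ∧ IsCompact U ∧ x ∈ U ∧ U ⊆ O := by
  simpa using exists_compact_clopen_between isCompact_singleton hO (Set.singleton_subset_iff.2 hx)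

theorem isDenseIdeal_compactIdeal (X : PZLC.{u}) : IsDenseIdeal X.compactIdeal := by
  intro b hb
  obtain ⟨x, hx⟩ : (b.1 : Set X.carrier).Nonempty := by
    by_contra h
    exact hb (Subtype.ext (Clopens.ext (Set.not_nonempty_iff_eq_empty.1 h)))
  obtain ⟨U, hU, hUc, hxU, hUb⟩ := exists_compact_clopen_mem b.1.isOpen hx
  refine ⟨ofCompact U hU hUc, hUc, fun h => ?_, hUb⟩
  have : x ∈ ((⊥ : X.clopenAlgebra).1 : Set X.carrier) := h ▸ hxU
  exact this

theorem compactIdeal_eq_top_or_isPrime (X : PZLC.{u}) :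
    X.compactIdeal = ⊤ ∨ X.compactIdeal.IsPrime := by
  by_cases h : X.compactIdeal = ⊤
  · exact .inl h
  · have := Ideal.isProper_of_ne_top h
    exact .inr (Ideal.isPrime_of_mem_or_compl_mem fun {U} => U.2)

/-- The prime local Boolean algebra of a Boolean space. -/
def toPLBA (X : PZLC.{u}) : PLBA.{u} where
  carrier := X.clopenAlgebra
  ideal := X.compactIdeal
  dense := X.isDenseIdeal_compactIdeal
  eq_top_or_isPrime := X.compactIdeal_eq_top_or_isPrime

/-- The preimage map of a perfect map. -/
def preimageHom {X Y : PZLC.{u}} (f : X ⟶ Y) :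
    BoundedLatticeHom Y.clopenAlgebra X.clopenAlgebra where
  toFun V := ⟨⟨f.toFun ⁻¹' V.1, V.1.isClopen.preimage f.isPerfectMap.continuous⟩,
    V.2.imp (isPerfectMap_iff_isProperMap.1 f.isPerfectMap).isCompact_preimage
      (isPerfectMap_iff_isProperMap.1 f.isPerfectMap).isCompact_preimage⟩
  map_sup' _ _ := rfl
  map_inf' _ _ := rfl
  map_top' := rfl
  map_bot' := rfl

/-- The preimage map of a perfect map, as a morphism of prime local Boolean algebras. -/
def toPLBAMap {X Y : PZLC.{u}} (f : X ⟶ Y) : Y.toPLBA ⟶ X.toPLBA where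
  toLBAHom :=
    { toHom := preimageHom f
      cofinal := fun U hU => by
        obtain ⟨V, hV, hVc, hUV, -⟩ := exists_compact_clopen_between
          (IsCompact.image hU f.isPerfectMap.continuous) isOpen_univ (Set.subset_univ _)
        exact ⟨ofCompact V hV hVc, hVc, fun x hx => hUV (Set.mem_image_of_mem _ hx)⟩ }
  map_mem _ hV := (isPerfectMap_iff_isProperMap.1 f.isPerfectMap).isCompact_preimage hV

/-- The contravariant functor sending a Boolean space to its algebra of compact and cocompact
clopen sets. -/
def clopenFunctor : PZLC.{u}ᵒᵖ ⥤ PLBA.{u} where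
  obj X := X.unop.toPLBA
  map f := toPLBAMap f.unop
  map_id _ := rfl
  map_comp _ _ := rfl

/-! ### Reconstructing a perfect map from its preimage map -/

instance : clopenFunctor.{u}.Faithful where
  map_injective {X Y} f g h := by
    refine Quiver.Hom.unop_inj (Hom.ext (funext fun x => ?_))
    by_contra hne
    obtain ⟨U, hU, hUc, hxU, hgU⟩ := exists_compact_clopen_mem isOpen_compl_singleton hne
    have hfg : preimageHom f.unop (ofCompact U hU hUc) = preimageHom g.unop (ofCompact U hU hUc) :=
      congrArg (fun φ : X.unop.toPLBA ⟶ Y.unop.toPLBA => φ.toLBAHom.toHom (ofCompact U hU hUc)) h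
    have hx : x ∈ ((preimageHom g.unop (ofCompact U hU hUc)).1 : Set Y.unop.carrier) :=
      hfg ▸ (show x ∈ ((preimageHom f.unop (ofCompact U hU hUc)).1 : Set Y.unop.carrier) from hxU)
    exact hgU hx rfl

/-- A morphism of algebras `φ` assigns to a point `x` of `X` a point of `Y`, namely the common point
of the compact clopen sets `V` with `x ∈ φ V`. -/
theorem exists_point {X Y : PZLC.{u}} (φ : Y.toPLBA ⟶ X.toPLBA) (x : X.carrier) :
    ∃ y : Y.carrier, ∀ V : Y.clopenAlgebra,
      x ∈ ((φ.toLBAHom.toHom V).1 : Set X.carrier) ↔ y ∈ (V.1 : Set Y.carrier) := by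
  let ψ : BoundedLatticeHom Y.clopenAlgebra X.clopenAlgebra := φ.toLBAHom.toHom
  change ∃ y : Y.carrier, ∀ V : Y.clopenAlgebra,
    x ∈ ((ψ V).1 : Set X.carrier) ↔ y ∈ (V.1 : Set Y.carrier)
  have hinf (V W) : x ∈ ((ψ (V ⊓ W)).1 : Set X.carrier) ↔
      x ∈ ((ψ V).1 : Set X.carrier) ∧ x ∈ ((ψ W).1 : Set X.carrier) := by
    rw [map_inf]; rfl
  have hcompl (V) : x ∈ ((ψ Vᶜ).1 : Set X.carrier) ↔ x ∉ ((ψ V).1 : Set X.carrier) := by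
    rw [map_compl']; rfl
  let ι := {V : Y.clopenAlgebra // V ∈ Y.compactIdeal ∧ x ∈ ((ψ V).1 : Set X.carrier)}
  obtain ⟨V₀, hV₀, hxV₀⟩ : ∃ V ∈ Y.compactIdeal, x ∈ ((ψ V).1 : Set X.carrier) := by
    obtain ⟨U, hU, hUc, hxU, -⟩ := exists_compact_clopen_mem isOpen_univ (Set.mem_univ x)
    obtain ⟨V, hV, hUV⟩ := φ.toLBAHom.cofinal (ofCompact U hU hUc) hUc
    exact ⟨V, hV, hUV hxU⟩
  have : Nonempty ι := ⟨⟨V₀, hV₀, hxV₀⟩⟩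
  obtain ⟨y, hy⟩ := IsCompact.nonempty_iInter_of_directed_nonempty_isCompact_isClosed
    (fun V : ι => (V.1.1 : Set Y.carrier))
    (fun V W => ⟨⟨V.1 ⊓ W.1, Y.compactIdeal.lower inf_le_left V.2.1, (hinf _ _).2 ⟨V.2.2, W.2.2⟩⟩,
      Set.inter_subset_left, Set.inter_subset_right⟩)
    (fun V => by
      by_contra h
      have hbot : V.1 = ⊥ := Subtype.ext (Clopens.ext (Set.not_nonempty_iff_eq_empty.1 h))
      have hx := V.2.2
      rw [hbot, map_bot] at hx
      exact hx)
    (fun V => V.2.1) (fun V => V.1.1.isClosed)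
  rw [Set.mem_iInter] at hy
  -- Intersecting with `V₀` reduces membership in an arbitrary `V` to the compact case.
  have key (V : Y.clopenAlgebra) (hV : x ∈ ((ψ V).1 : Set X.carrier)) :
      y ∈ (V.1 : Set Y.carrier) :=
    (hy ⟨V ⊓ V₀, Y.compactIdeal.lower inf_le_right hV₀, (hinf _ _).2 ⟨hV, hxV₀⟩⟩).1
  refine ⟨y, fun V => ⟨key V, fun hyV => ?_⟩⟩
  by_contra hxV
  exact key Vᶜ ((hcompl V).2 hxV) hyV

/-- A map whose preimages of compact clopen sets are compact and clopen is perfect. -/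
theorem isPerfectMap_of_preimage {X Y : PZLC.{u}} {f : X.carrier → Y.carrier}
    (hf : ∀ V : Set Y.carrier, IsClopen V → IsCompact V →
      IsClopen (f ⁻¹' V) ∧ IsCompact (f ⁻¹' V)) : IsPerfectMap f := by
  have hcont : Continuous f := by
    refine continuous_def.2 fun O hO => isOpen_iff_mem_nhds.2 fun x hx => ?_
    obtain ⟨V, hV, hVc, hxV, hVO⟩ := exists_compact_clopen_mem hO hx
    exact Filter.mem_of_superset ((hf V hV hVc).1.2.mem_nhds hxV) (Set.preimage_mono hVO)
  refine isPerfectMap_iff_isProperMap.2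
    (isProperMap_iff_isCompact_preimage.2 ⟨hcont, fun K hK => ?_⟩)
  obtain ⟨V, hV, hVc, hKV, -⟩ := exists_compact_clopen_between hK isOpen_univ (Set.subset_univ _)
  exact (hf V hV hVc).2.of_isClosed_subset (hK.isClosed.preimage hcont) (Set.preimage_mono hKV)

instance : clopenFunctor.{u}.Full where
  map_surjective {X Y} φ := by
    choose f hf using exists_point (X := Y.unop) (Y := X.unop) φ
    have hpre (V : X.unop.clopenAlgebra) : f ⁻¹' V.1 = (φ.toLBAHom.toHom V).1.carrier :=
      Set.ext fun x => (hf x V).symm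
    have hperf : IsPerfectMap f := isPerfectMap_of_preimage fun V hV hVc => by
      rw [show f ⁻¹' V = _ from hpre (ofCompact V hV hVc)]
      exact ⟨Clopens.isClopen _, φ.map_mem _ hVc⟩
    let g : Y.unop ⟶ X.unop := ⟨f, hperf⟩
    refine ⟨g.op, PLBA.Hom.ext (LBA.Hom.ext (DFunLike.ext _ _ fun V => ?_))⟩
    exact Subtype.ext (Clopens.ext (hpre V))

end PZLC

/-! ### The Boolean space of a prime local Boolean algebra -/

namespace LocalStone

variable {A : Type u} [BooleanAlgebra A]

variable (A) in
/-- The ultrafilters of a Boolean algebra, encoded by their characteristic functions. -/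
def ultrafilters : Set (A → Bool) :=
  {x | (∀ a, x aᶜ = !x a) ∧ (∀ a b, x (a ⊓ b) = (x a && x b)) ∧ x ⊤ = true}

theorem isClosed_ultrafilters : IsClosed (ultrafilters A) := by
  simp only [ultrafilters, Set.ofPred_and, Set.ofPred_forall]
  have h (a : A) : Continuous fun x : A → Bool => x a := continuous_apply a
  have hand : Continuous fun p : Bool × Bool => (p.1 && p.2) := continuous_of_discreteTopology
  have hnot : Continuous fun p : Bool => !p := continuous_of_discreteTopology
  refine .inter (isClosed_iInter fun a => isClosed_eq (h _) (hnot.comp (h _))) (.inter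
    (isClosed_iInter fun a => isClosed_iInter fun b => isClosed_eq (h _) ?_)
    (isClosed_eq (h _) continuous_const))
  exact hand.comp ((h a).prodMk (h b))

/-- The ultrafilters that meet the ideal `I`, with the topology of pointwise convergence of
characteristic functions. -/
abbrev Point (I : Ideal A) : Type u := {x : A → Bool // x ∈ ultrafilters A ∧ ∃ a ∈ I, x a = true}

variable {I : Ideal A}

theorem Point.map_compl (x : Point I) (a : A) : x.1 aᶜ = !x.1 a := x.2.1.1 a

theorem Point.map_inf (x : Point I) (a b : A) : x.1 (a ⊓ b) = (x.1 a && x.1 b) := x.2.1.2.1 a b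

theorem Point.map_top (x : Point I) : x.1 ⊤ = true := x.2.1.2.2

theorem Point.map_bot (x : Point I) : x.1 ⊥ = false := by
  rw [← compl_top, x.map_compl, x.map_top, Bool.not_true]

theorem Point.map_sup (x : Point I) (a b : A) : x.1 (a ⊔ b) = (x.1 a || x.1 b) := by
  rw [← compl_compl (a ⊔ b), compl_sup, x.map_compl, x.map_inf, x.map_compl, x.map_compl]
  simp

theorem Point.mono (x : Point I) {a b : A} (h : a ≤ b) (ha : x.1 a = true) : x.1 b = true := by
  have := x.map_inf a b
  rw [inf_eq_left.2 h, ha, Bool.true_and] at this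
  exact this.symm

/-- The set of points containing `a`. -/
def cyl (I : Ideal A) (a : A) : Set (Point I) := {x | x.1 a = true}

theorem isClopen_cyl (a : A) : IsClopen (cyl I a) :=
  (isClopen_discrete {true}).preimage ((continuous_apply a).comp continuous_subtype_val)

theorem cyl_compl (a : A) : cyl I aᶜ = (cyl I a)ᶜ := by
  ext x; simp [cyl, x.map_compl]

theorem cyl_inf (a b : A) : cyl I (a ⊓ b) = cyl I a ∩ cyl I b := by
  ext x; simp [cyl, x.map_inf]

theorem cyl_sup (a b : A) : cyl I (a ⊔ b) = cyl I a ∪ cyl I b := by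
  ext x; simp [cyl, x.map_sup]

theorem cyl_bot : cyl I ⊥ = ∅ := by
  ext x; simp [cyl, x.map_bot]

theorem cyl_mono {a b : A} (h : a ≤ b) : cyl I a ⊆ cyl I b := fun x => x.mono h

theorem isCompact_cyl {a : A} (ha : a ∈ I) : IsCompact (cyl I a) := by
  rw [Subtype.isCompact_iff]
  have : Subtype.val '' cyl I a = ultrafilters A ∩ {x | x a = true} := by
    ext x
    exact ⟨fun ⟨y, hy, h⟩ => h ▸ ⟨y.2.1, hy⟩, fun h => ⟨⟨x, h.1, a, ha, h.2⟩, h.2, rfl⟩⟩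
  rw [this]
  exact (isClosed_ultrafilters.inter (isClosed_eq (continuous_apply a) continuous_const)).isCompact

instance : LocallyCompactSpace (Point I) := by
  have h : IsOpen {x : A → Bool | ∃ a ∈ I, x a = true} := by
    have : {x : A → Bool | ∃ a ∈ I, x a = true} = ⋃ a ∈ I, {x | x a = true} := by
      ext x; simp
    rw [this]
    exact isOpen_biUnion fun a _ =>
      (isOpen_discrete {true}).preimage (continuous_apply (A := fun _ : A => Bool) a)
  exact (isClosed_ultrafilters.isLocallyClosed.inter h.isLocallyClosed).locallyCompactSpace

theorem isTopologicalBasis_cyl : IsTopologicalBasis (Set.range (cyl I)) := by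
  refine isTopologicalBasis_of_isOpen_of_nhds (Set.forall_mem_range.2 fun a => (isClopen_cyl a).2)
    fun x O hxO hO => ?_
  obtain ⟨O', hO', rfl⟩ := isOpen_induced_iff.1 hO
  obtain ⟨F, u, hu, hFu⟩ := isOpen_pi_iff.1 hO' x.1 hxO
  -- A finite set of coordinates of `x` is determined by membership of a single element.
  have key (F : Finset A) : ∃ c : A, x.1 c = true ∧ ∀ y ∈ cyl I c, ∀ a ∈ F, y.1 a = x.1 a := by
    classical
    induction F using Finset.induction_on with
    | empty => exact ⟨⊤, x.map_top, by simp⟩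
    | insert a F _ ih =>
      obtain ⟨c, hc, hcF⟩ := ih
      refine ⟨c ⊓ (if x.1 a then a else aᶜ), ?_, fun y hy b hb => ?_⟩
      · cases h : x.1 a <;> simp [x.map_inf, x.map_compl, hc, h]
      · rw [cyl_inf] at hy
        rcases Finset.mem_insert.1 hb with rfl | hb
        · have hy2 := hy.2
          cases h : x.1 b <;> simpa [cyl, y.map_compl, h] using hy2
        · exact hcF y hy.1 b hb
  obtain ⟨c, hc, hcF⟩ := key F
  exact ⟨_, ⟨c, rfl⟩, hc, fun y hy => hFu fun a ha => by rw [hcF y hy a ha]; exact (hu a ha).2⟩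

/-- By the prime ideal theorem and density of `I`, every nonzero element lies in a point. -/
theorem cyl_nonempty (hI : IsDenseIdeal I) {a : A} (ha : a ≠ ⊥) : (cyl I a).Nonempty := by
  classical
  obtain ⟨c, hcI, hc, hca⟩ := hI a ha
  obtain ⟨J, hJ, -, hcJ⟩ := DistribLattice.prime_ideal_of_disjoint_filter_ideal
    (F := PFilter.principal c) (I := Ideal.principal (⊥ : A)) (Set.disjoint_left.2 fun b hb hb' =>
      hc (le_bot_iff.1 (le_trans (PFilter.mem_principal.1 hb) (Ideal.mem_principal.1 hb'))))
  have hc' (b : A) (hb : c ≤ b) : b ∉ J :=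
    fun h => Set.disjoint_left.1 hcJ (PFilter.mem_principal.2 hb) h
  have hcompl (b : A) : bᶜ ∉ J ↔ b ∈ J :=
    ⟨hJ.mem_or_compl_mem.resolve_right, fun h h' => hJ.toIsProper.notMem_of_compl_mem h' h⟩
  have hinf (b d : A) : b ⊓ d ∉ J ↔ b ∉ J ∧ d ∉ J :=
    ⟨fun h => ⟨fun hb => h (J.lower inf_le_left hb), fun hd => h (J.lower inf_le_right hd)⟩,
      fun h h' => (hJ.mem_or_mem h').elim h.1 h.2⟩
  refine ⟨⟨fun b => decide (b ∉ J), ⟨fun b => ?_, fun b d => ?_, ?_⟩, c, hcI, ?_⟩, ?_⟩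
  · simp [hcompl]
  · simp [hinf]
  · simpa using hc' ⊤ le_top
  · simpa using hc' c le_rfl
  · simpa [cyl] using hc' a hca

theorem cyl_subset_cyl (hI : IsDenseIdeal I) {a b : A} : cyl I a ⊆ cyl I b ↔ a ≤ b := by
  refine ⟨fun h => ?_, cyl_mono⟩
  by_contra hab
  obtain ⟨x, hx⟩ := cyl_nonempty hI (a := a ⊓ bᶜ) fun h => hab (by
    rwa [← sdiff_eq, sdiff_eq_bot_iff] at h)
  rw [cyl_inf, cyl_compl] at hx
  exact hx.2 (h hx.1)

theorem isCompact_cyl_iff (hI : IsDenseIdeal I) {a : A} : IsCompact (cyl I a) ↔ a ∈ I := by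
  refine ⟨fun h => ?_, isCompact_cyl⟩
  have : Nonempty I := I.nonempty.to_subtype
  obtain ⟨c, hc⟩ := h.elim_directed_cover (fun c : I => cyl I c) (fun c => (isClopen_cyl _).2)
    (fun x _ => let ⟨c, hc, hxc⟩ := x.2.2; Set.mem_iUnion.2 ⟨⟨c, hc⟩, hxc⟩)
    (fun c d => ⟨⟨c ⊔ d, Ideal.sup_mem c.2 d.2⟩, cyl_mono le_sup_left, cyl_mono le_sup_right⟩)
  exact I.lower ((cyl_subset_cyl hI).1 hc) c.2

theorem exists_cyl_eq_of_isCompact {U : Set (Point I)} (hU : IsOpen U) (hc : IsCompact U) :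
    ∃ a, cyl I a = U := by
  obtain ⟨s, hs, rfl⟩ := eq_finite_iUnion_of_isTopologicalBasis_of_isCompact_open (cyl I)
    isTopologicalBasis_cyl U hc hU
  clear hU hc
  induction s, hs using Set.Finite.induction_on with
  | empty => exact ⟨⊥, by simp [cyl_bot]⟩
  | @insert a s _ _ ih =>
    obtain ⟨b, hb⟩ := ih
    exact ⟨a ⊔ b, by rw [cyl_sup, hb, Set.biUnion_insert]⟩

variable (I) in
/-- The Boolean space of ultrafilters meeting `I`. -/
def space : PZLC.{u} where
  carrier := Point I
  zeroDim := loc_compact_Haus_tot_disc_of_zero_dim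

/-- Each element of a prime local Boolean algebra, viewed as a compact or cocompact clopen set. -/
def toClopen (hI : I = ⊤ ∨ I.IsPrime) (a : A) : (space I).clopenAlgebra :=
  ⟨⟨cyl I a, isClopen_cyl a⟩, by
    have : a ∈ I ∨ aᶜ ∈ I := hI.elim (fun h => .inl (h ▸ trivial)) fun h => h.mem_or_compl_mem
    refine this.imp isCompact_cyl fun h => ?_
    change IsCompact (cyl I a)ᶜ
    exact cyl_compl a ▸ isCompact_cyl h⟩

theorem toClopen_surjective (hI : I = ⊤ ∨ I.IsPrime) : Function.Surjective (toClopen hI) := by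
  rintro ⟨U, hU⟩
  suffices ∃ a, cyl I a = U.carrier by
    obtain ⟨a, ha⟩ := this
    exact ⟨a, Subtype.ext (Clopens.ext ha)⟩
  rcases hU with hU | hU
  · exact exists_cyl_eq_of_isCompact U.isOpen hU
  · obtain ⟨a, ha⟩ := exists_cyl_eq_of_isCompact U.isClosed.isOpen_compl hU
    exact ⟨aᶜ, (cyl_compl a).trans ((congrArg compl ha).trans (compl_compl U.carrier))⟩

/-- A prime local Boolean algebra is isomorphic to the algebra of compact and cocompact clopen
subsets of its space. -/
noncomputable def orderIso (hI : I = ⊤ ∨ I.IsPrime) (hd : IsDenseIdeal I) :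
    A ≃o (space I).clopenAlgebra :=
  RelIso.ofSurjective (OrderEmbedding.ofMapLEIff (toClopen hI) fun _ _ => cyl_subset_cyl hd)
    (toClopen_surjective hI)

end LocalStone

/-- An order isomorphism of the algebras that identifies the ideals is an isomorphism in `PLBA`. -/
def PLBA.isoOfOrderIso {A B : PLBA.{u}} (e : A.carrier ≃o B.carrier)
    (h : ∀ a, e a ∈ B.ideal ↔ a ∈ A.ideal) : A ≅ B where
  hom :=
    { toLBAHom :=
        { toHom := (e : BoundedLatticeHom A.carrier B.carrier)
          cofinal := fun b hb =>
            ⟨e.symm b, (h _).1 (by simpa using hb), (e.apply_symm_apply b).ge⟩ }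
      map_mem := fun a ha => (h a).2 ha }
  inv :=
    { toLBAHom :=
        { toHom := (e.symm : BoundedLatticeHom B.carrier A.carrier)
          cofinal := fun a ha => ⟨e a, (h a).2 ha, (e.symm_apply_apply a).ge⟩ }
      map_mem := fun b hb => (h _).1 (show e (e.symm b) ∈ B.ideal by simpa using hb) }
  hom_inv_id := PLBA.Hom.ext (LBA.Hom.ext (DFunLike.ext _ _ e.symm_apply_apply))
  inv_hom_id := PLBA.Hom.ext (LBA.Hom.ext (DFunLike.ext _ _ e.apply_symm_apply))

instance : PZLC.clopenFunctor.{u}.EssSurj where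
  mem_essImage A :=
    ⟨.op (LocalStone.space A.ideal),
      ⟨(PLBA.isoOfOrderIso (B := (LocalStone.space A.ideal).toPLBA)
        (LocalStone.orderIso A.eq_top_or_isPrime A.dense)
        fun _ => LocalStone.isCompact_cyl_iff A.dense).symm⟩⟩

instance : PZLC.clopenFunctor.{u}.IsEquivalence where

/-- The category of Boolean spaces and perfect maps is dually equivalent to the category of prime
local Boolean algebras. -/
theorem theorem1p20 : Nonempty (PZLC.{u}ᵒᵖ ≌ PLBA.{u}) :=
  ⟨PZLC.clopenFunctor.asEquivalence⟩
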